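/- **Setting.** Fix a countable set $AP$. A *stochastic Markov model* (SMM) is a tuple $\mathcal M=(S,A,\tau,\rho,\ell)$ with a finite nonempty set $S$ of states, a set $A\subseteq S$ of absorbing states, $\tau\colon S\setminus A\to\mathcal D(S)$ (discrete probability distributions on $S$), $\rho\colon S\setminus A\to\Delta([0,\infty))$ (Borel probability measures, the residence-time distributions), and $\ell\colon S\to 2^{AP}$. Write $s\equiv s'$ if $\ell(s)=\ell(s')$ and ($s\in A\iff s'\in A$). $\Omega(\mu,\nu)$ is the set of couplings of $\mu$ and $\nu$, i.e. of probability measures on the product with marginals $\mu,\nu$. **Coupling models.** A *coupling model* $\mathcal C$ for $\mathcal M$ has the state set $S\times S$, the absorbing set $A'=(A\times S)\cup(S\times A)$, the labels $\ell'(s,s')=(\ell(s),\ell(s'))$, and assigns to all $s,s'\notin A$ couplings $\tau'(s,s')\in\Omega(\tau(s),\tau(s'))$ and $\rho'(s,s')\in\Omega(\rho(s),\rho(s'))$. It induces, for each initial pair $p$, a probability measure $\Pr^{\mathcal C}_{p}$ on coupled timed paths $(x_0,x_0'),(t_0,t_0'),(x_1,x_1'),(t_1,t_1'),\dots$: $(x_0,x_0')=p$;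 from a pair $u\notin A'$, independently of the past, the pair of delays is drawn from $\rho'(u)$ and, independently, the next pair of states from $\tau'(u)$; in a pair $u\in A'$ the path stops, which is represented by infinite delays and by staying in $u$ forever. The *discrepancy* $\mathrm{disc}_{\mathcal C}(s,s')$ is the $\Pr^{\mathcal C}_{(s,s')}$-probability that for some $k\in\mathbb N$ one has $x_k\not\equiv x_k'$ or $t_k\ne t_k'$. Let $$\vartheta^{\mathcal M}(s,s')=\min\{\mathrm{disc}_{\mathcal C}(s,s') : \mathcal C\text{ a coupling model for }\mathcal M\}.$$ **Operator.** For $d\colon S\times S\to[0,1]$ and $\mu,\nu\in\mathcal D(S)$ let $\mathcal K_d(\mu,\nu)=\inf_{\omega\in\Omega(\mu,\nu)}\sum_{u,v\in S}\omega(u,v)\,d(u,v)$, and for probability measures $\mu,\nu$ on $[0,\infty)$ let $\|\mu-\nu\|=\sup_{E\text{ Borel}}|\mu(E)-\nu(E)|$. The operator $F^{\mathcal M}$ on the complete lattice (pointwise order) of functions $S\times S\to[0,1]$ is $$F^{\mathcal M}(d)(s,s')=\begin{cases}1 & s\not\equiv s',\\ 0 & s\equiv s',\ s,s'\in A,\\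 \alpha+(1-\alpha)\,\mathcal K_d(\tau(s),\tau(s'))\ \text{ with }\alpha=\|\rho(s)-\rho(s')\| & \text{otherwise.}\end{cases}$$ It is monotone; let $f^{\mathcal M}$ be its least fixed point. **Lemma.** For every SMM $\mathcal M$, the minimum defining $\vartheta^{\mathcal M}(s,s')$ is attained for all $s,s'\in S$, and $f^{\mathcal M}=\vartheta^{\mathcal M}$. -/

import Mathlib

open MeasureTheory ProbabilityTheory
open scoped ENNReal NNReal unitInterval

noncomputable section

/-! ### Couplings, total variation and the Kantorovich lifting -/

/-- A measure `ω` on a product is a coupling of `(μ, ν)` if its marginals are `μ` and `ν`. -/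
def MeasureCoupling {X Y : Type*} [MeasurableSpace X] [MeasurableSpace Y]
    (μ : Measure X) (ν : Measure Y) (ω : Measure (X × Y)) : Prop :=
  ω.map Prod.fst = μ ∧ ω.map Prod.snd = ν

/-- Couplings of discrete probability distributions. -/
def DiscreteCoupling {X Y : Type*} (μ : PMF X) (ν : PMF Y) (ω : PMF (X × Y)) : Prop :=
  ω.map Prod.fst = μ ∧ ω.map Prod.snd = ν

/-- Total variation distance: `sup_E |μ E - ν E|` over the measurable sets `E`. -/
def tvDistance {X : Type*} [MeasurableSpace X] (μ ν : Measure X) : ℝ :=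
  ⨆ E : {E : Set X // MeasurableSet E}, |μ.real E.1 - ν.real E.1|

/-- The Kantorovich lifting of `d : S × S → [0,1]` to distributions on the finite set `S`:
the infimum, over all couplings `ω`, of `∑ ω(u,v) d(u,v)`. -/
def kantorovich {S : Type*} [Fintype S] (d : S × S → I) (μ ν : PMF S) : ℝ :=
  ⨅ ω : {ω : PMF (S × S) // DiscreteCoupling μ ν ω}, ∑ p : S × S, (ω.1 p).toReal * (d p : ℝ)

theorem tvDistance_mem {X : Type*} [MeasurableSpace X] (μ ν : Measure X)
    [IsProbabilityMeasure μ] [IsProbabilityMeasure ν] : tvDistance μ ν ∈ I := by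
  refine ⟨Real.iSup_nonneg fun E => abs_nonneg _, Real.iSup_le (fun E => ?_) zero_le_one⟩
  rw [abs_le]
  constructor <;>
    linarith [measureReal_nonneg (μ := μ) (s := E.1), measureReal_nonneg (μ := ν) (s := E.1),
      measureReal_le_one (μ := μ) (s := E.1), measureReal_le_one (μ := ν) (s := E.1)]

theorem nonempty_discreteCoupling {X Y : Type*} (μ : PMF X) (ν : PMF Y) :
    Nonempty {ω : PMF (X × Y) // DiscreteCoupling μ ν ω} := by
  refine ⟨⟨μ.bind fun x => ν.map (Prod.mk x), ?_, ?_⟩⟩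
  · simp only [PMF.map_bind, PMF.map_comp]
    have : ∀ x : X, (Prod.fst ∘ Prod.mk x : Y → X) = Function.const Y x := fun x => rfl
    simp [this, PMF.map_const]
  · simp only [PMF.map_bind, PMF.map_comp]
    have : ∀ x : X, (Prod.snd ∘ Prod.mk x : Y → Y) = id := fun x => rfl
    simp [this, PMF.map_id]

section Kantorovich

variable {S : Type*} [Fintype S]

theorem kantorovich_bddBelow (d : S × S → I) (μ ν : PMF S) :
    BddBelow (Set.range fun ω : {ω : PMF (S × S) // DiscreteCoupling μ ν ω} =>
      ∑ p : S × S, (ω.1 p).toReal * (d p : ℝ)) := by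
  refine ⟨0, ?_⟩
  rintro _ ⟨ω, rfl⟩
  exact Finset.sum_nonneg fun p _ => mul_nonneg ENNReal.toReal_nonneg (d p).2.1

theorem kantorovich_mem (d : S × S → I) (μ ν : PMF S) : kantorovich d μ ν ∈ I := by
  obtain ⟨ω⟩ := nonempty_discreteCoupling μ ν
  refine ⟨Real.iInf_nonneg fun _ => Finset.sum_nonneg fun p _ =>
    mul_nonneg ENNReal.toReal_nonneg (d p).2.1, ?_⟩
  refine (ciInf_le (kantorovich_bddBelow d μ ν) ω).trans ?_
  have h1 : ∑ p : S × S, (ω.1 p).toReal = 1 := by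
    rw [← ENNReal.toReal_sum fun p _ => ω.1.apply_ne_top p, ← tsum_fintype (L := .unconditional _),
      ω.1.tsum_coe, ENNReal.toReal_one]
  calc ∑ p : S × S, (ω.1 p).toReal * (d p : ℝ) ≤ ∑ p : S × S, (ω.1 p).toReal :=
        Finset.sum_le_sum fun p _ => mul_le_of_le_one_right ENNReal.toReal_nonneg (d p).2.2
    _ = 1 := h1

theorem kantorovich_mono (μ ν : PMF S) {d d' : S × S → I} (h : d ≤ d') :
    kantorovich d μ ν ≤ kantorovich d' μ ν :=
  ciInf_mono (kantorovich_bddBelow d μ ν) fun _ => Finset.sum_le_sum fun p _ =>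
    mul_le_mul_of_nonneg_left (h p) ENNReal.toReal_nonneg

end Kantorovich

/-! ### Stochastic Markov models -/

/-- A stochastic Markov model with atomic propositions `AP` and (finite) set of states `S`:
a set `A` of absorbing states, and, for every non-absorbing state, a distribution `τ` of the next
state and a residence-time distribution `ρ` on `[0,∞)`; `ℓ` labels the states. -/
structure SMM (AP S : Type*) where
  A : Set S
  τ : (Aᶜ : Set S) → PMF S
  ρ : (Aᶜ : Set S) → ProbabilityMeasure ℝ≥0
  ℓ : S → Set AP

namespace SMM

variable {AP S : Type*}

/-- `s ≡ s'`: same label, and both or none absorbing. -/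
def Similar (M : SMM AP S) (s s' : S) : Prop :=
  M.ℓ s = M.ℓ s' ∧ (s ∈ M.A ↔ s' ∈ M.A)

open Classical in
/-- The real number `F(d)(s,s')`. In the second case `s ≡ s'` and `s ∈ A`, so `s' ∈ A` too. -/
def operatorFun [Fintype S] (M : SMM AP S) (d : S × S → I) (p : S × S) : ℝ :=
  if hE : M.Similar p.1 p.2 then
    if hA : p.1 ∈ M.A then 0
    else
      let s : (M.Aᶜ : Set S) := ⟨p.1, hA⟩
      let s' : (M.Aᶜ : Set S) := ⟨p.2, fun h => hA (hE.2.mpr h)⟩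
      let α : ℝ := tvDistance (M.ρ s : Measure ℝ≥0) (M.ρ s' : Measure ℝ≥0)
      α + (1 - α) * kantorovich d (M.τ s) (M.τ s')
  else 1

theorem operatorFun_mem [Fintype S] (M : SMM AP S) (d : S × S → I) (p : S × S) :
    M.operatorFun d p ∈ I := by
  unfold operatorFun
  split_ifs with hE hA
  · exact ⟨le_rfl, zero_le_one⟩
  · have h1 := tvDistance_mem (M.ρ ⟨p.1, hA⟩ : Measure ℝ≥0)
      (M.ρ ⟨p.2, fun h => hA (hE.2.mpr h)⟩ : Measure ℝ≥0)
    have h2 := kantorovich_mem d (M.τ ⟨p.1, hA⟩) (M.τ ⟨p.2, fun h => hA (hE.2.mpr h)⟩)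
    refine ⟨?_, ?_⟩
    · have := mul_nonneg (sub_nonneg.2 h1.2) h2.1
      exact add_nonneg h1.1 this
    · have := mul_le_of_le_one_right (sub_nonneg.2 h1.2) h2.2
      dsimp only
      linarith
  · exact ⟨zero_le_one, le_rfl⟩

theorem operatorFun_mono [Fintype S] (M : SMM AP S) {d d' : S × S → I} (h : d ≤ d')
    (p : S × S) : M.operatorFun d p ≤ M.operatorFun d' p := by
  unfold operatorFun
  split_ifs with hE hA
  · exact le_rfl
  · have h1 := tvDistance_mem (M.ρ ⟨p.1, hA⟩ : Measure ℝ≥0)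
      (M.ρ ⟨p.2, fun h => hA (hE.2.mpr h)⟩ : Measure ℝ≥0)
    exact add_le_add_right (mul_le_mul_of_nonneg_left (kantorovich_mono _ _ h)
      (sub_nonneg.2 h1.2)) _
  · exact le_rfl

/-- The monotone operator `F` on the complete lattice of functions `S × S → [0,1]`. -/
def fixedPointOperator [Fintype S] (M : SMM AP S) : (S × S → I) →o (S × S → I) where
  toFun d p := ⟨M.operatorFun d p, M.operatorFun_mem d p⟩
  monotone' _ _ h p := M.operatorFun_mono h p

/-- The least fixed point of `F`. -/
def leastFixedPoint [Fintype S] (M : SMM AP S) : S × S → I :=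
  M.fixedPointOperator.lfp

/-! ### Coupling models and coupled timed paths -/

/-- The absorbing pairs `(A × S) ∪ (S × A)` of a coupling model. -/
def coupledA (M : SMM AP S) : Set (S × S) := {p | p.1 ∈ M.A ∨ p.2 ∈ M.A}

theorem fst_mem {M : SMM AP S} (p : (M.coupledAᶜ : Set (S × S))) : p.1.1 ∈ M.Aᶜ :=
  fun h => p.2 (Or.inl h)

theorem snd_mem {M : SMM AP S} (p : (M.coupledAᶜ : Set (S × S))) : p.1.2 ∈ M.Aᶜ :=
  fun h => p.2 (Or.inr h)

/-- A coupling model: its states are the pairs of states, the absorbing ones are `coupledA`, the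
label of `(s, s')` is `(ℓ s, ℓ s')`, and to every non-absorbing pair it assigns a coupling of the
transition distributions and a coupling of the residence-time distributions. -/
structure CouplingModel (M : SMM AP S) where
  τ' : (M.coupledAᶜ : Set (S × S)) → PMF (S × S)
  ρ' : (M.coupledAᶜ : Set (S × S)) → ProbabilityMeasure (ℝ≥0 × ℝ≥0)
  coupling_τ' : ∀ p, DiscreteCoupling (M.τ ⟨p.1.1, fst_mem p⟩) (M.τ ⟨p.1.2, snd_mem p⟩) (τ' p)
  coupling_ρ' : ∀ p, MeasureCoupling (M.ρ ⟨p.1.1, fst_mem p⟩ : Measure ℝ≥0)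
    (M.ρ ⟨p.1.2, snd_mem p⟩ : Measure ℝ≥0) (ρ' p : Measure (ℝ≥0 × ℝ≥0))

end SMM

/-- Timed paths `x₀, t₀, x₁, t₁, …`. A path that stops in `xₙ` because no transition leaves `xₙ` is
represented by `tᵢ = ∞` and `xᵢ = xₙ` for all `i ≥ n`: the residence time there is infinite. -/
abbrev TimedPath (S : Type*) := ℕ → S × ℝ≥0∞

/-- Coupled timed paths `(x₀,x₀'), (t₀,t₀'), (x₁,x₁'), (t₁,t₁'), …`. -/
abbrev CoupledPath (S : Type*) := ℕ → (S × S) × (ℝ≥0∞ × ℝ≥0∞)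

/-- The pair of timed paths that a coupled timed path consists of. -/
def decouple {S : Type*} (π : CoupledPath S) : TimedPath S × TimedPath S :=
  (fun i => ((π i).1.1, (π i).2.1), fun i => ((π i).1.2, (π i).2.2))

/-- The cylinder of the coupled paths with states `u 0, …, u n` and delays in `R 0, …, R (n-1)`. -/
def cylinderSet {S : Type*} (u : ℕ → S × S) (R : ℕ → Set (ℝ≥0∞ × ℝ≥0∞)) (n : ℕ) :
    Set (CoupledPath S) :=
  {π | (∀ i ≤ n, (π i).1 = u i) ∧ ∀ i < n, (π i).2 ∈ R i}

theorem mem_cylinderSet_succ {S : Type*} (u : ℕ → S × S)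
    (R : ℕ → Set (ℝ≥0∞ × ℝ≥0∞)) (n : ℕ)
    (π : CoupledPath S) : π ∈ cylinderSet u R (n + 1) ↔
      (π ∈ cylinderSet u R n ∧ (π n).2 ∈ R n) ∧ (π (n + 1)).1 = u (n + 1) := by
  simp only [cylinderSet, Set.mem_ofPred_eq, Nat.forall_lt_succ_right, Nat.le_succ_iff,
    or_imp, forall_and, forall_eq]
  tauto

theorem measurable_decouple {S : Type*} [MeasurableSpace S] :
    Measurable (decouple : CoupledPath S → TimedPath S × TimedPath S) := by
  unfold decouple; fun_prop

/-- The set of pairs of timed paths which, at some position, have states `s ≢ s'` or distinct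
delays. -/
def SMM.discrepancySet {AP S : Type*} (M : SMM AP S) : Set (TimedPath S × TimedPath S) :=
  {π | ∃ k, ¬ M.Similar (π.1 k).1 (π.2 k).1 ∨ (π.1 k).2 ≠ (π.2 k).2}

namespace SMM.CouplingModel

variable {AP S : Type*} [Fintype S] [MeasurableSpace S] [DiscreteMeasurableSpace S] {M : SMM AP S}

open Classical in
/-- Law of the next pair of states; an absorbing pair is never left. -/
def nextLaw (C : M.CouplingModel) (u : S × S) : Measure (S × S) :=
  if h : u ∈ (M.coupledAᶜ : Set (S × S)) then (C.τ' ⟨u, h⟩).toMeasure else Measure.dirac u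

open Classical in
/-- Law of the pair of delays; the delays in an absorbing pair are infinite. -/
def delayLaw (C : M.CouplingModel) (u : S × S) : Measure (ℝ≥0∞ × ℝ≥0∞) :=
  if h : u ∈ (M.coupledAᶜ : Set (S × S)) then
    (C.ρ' ⟨u, h⟩ : Measure (ℝ≥0 × ℝ≥0)).map (fun t => ((t.1 : ℝ≥0∞), (t.2 : ℝ≥0∞)))
  else Measure.dirac (⊤, ⊤)

instance (C : M.CouplingModel) (u : S × S) : IsProbabilityMeasure (C.nextLaw u) := by
  unfold nextLaw; split_ifs <;> infer_instance

instance (C : M.CouplingModel) (u : S × S) : IsProbabilityMeasure (C.delayLaw u) := by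
  unfold delayLaw
  split_ifs
  · exact Measure.isProbabilityMeasure_map (by fun_prop)
  · infer_instance

def nextKernel (C : M.CouplingModel) : Kernel (S × S) (S × S) where
  toFun := C.nextLaw
  measurable' := Measurable.of_discrete

def delayKernel (C : M.CouplingModel) : Kernel (S × S) (ℝ≥0∞ × ℝ≥0∞) where
  toFun := C.delayLaw
  measurable' := Measurable.of_discrete

instance (C : M.CouplingModel) : IsMarkovKernel C.nextKernel :=
  ⟨fun u => inferInstanceAs (IsProbabilityMeasure (C.nextLaw u))⟩

instance (C : M.CouplingModel) : IsMarkovKernel C.delayKernel :=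
  ⟨fun u => inferInstanceAs (IsProbabilityMeasure (C.delayLaw u))⟩

/-- `u ↦` the law of `(u, t)` with `t` distributed as the delays in `u`. -/
def emitKernel (C : M.CouplingModel) : Kernel (S × S) ((S × S) × (ℝ≥0∞ × ℝ≥0∞)) :=
  Kernel.id ×ₖ C.delayKernel

/-- From `(u, t)`: choose the next pair of states given `u`, then the delays in that pair. -/
def stepKernel (C : M.CouplingModel) :
    Kernel ((S × S) × (ℝ≥0∞ × ℝ≥0∞)) ((S × S) × (ℝ≥0∞ × ℝ≥0∞)) :=
  (C.emitKernel ∘ₖ C.nextKernel).comap Prod.fst measurable_fst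

instance (C : M.CouplingModel) : IsMarkovKernel C.emitKernel := by
  unfold emitKernel; infer_instance

instance (C : M.CouplingModel) : IsMarkovKernel C.stepKernel := by
  unfold stepKernel; infer_instance

/-- The probability measure on coupled timed paths induced by the coupling model and an initial
pair of states. The lemmas `pathLaw_cylinder_zero` and `pathLaw_cylinder_succ` below verify the
equations for cylinders that determine it. -/
def pathLaw (C : M.CouplingModel) (p : S × S) : Measure (CoupledPath S) :=
  Kernel.trajMeasure (X := fun _ => (S × S) × (ℝ≥0∞ × ℝ≥0∞)) (C.emitKernel p)
    (fun n => C.stepKernel.comap (fun x => x ⟨n, Finset.mem_Iic.2 le_rfl⟩) (by fun_prop))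

instance (C : M.CouplingModel) (p : S × S) : IsProbabilityMeasure (C.pathLaw p) := by
  unfold pathLaw; infer_instance

theorem pathLaw_map_zero (C : M.CouplingModel) (p : S × S) :
    (C.pathLaw p).map (fun π => π 0) = C.emitKernel p := by
  have h : (fun π : CoupledPath S => π 0) =
      (fun x : (i : Finset.Iic 0) → (S × S) × (ℝ≥0∞ × ℝ≥0∞) => x ⟨0, Finset.mem_Iic.2 le_rfl⟩) ∘
        Preorder.frestrictLe (π := fun _ : ℕ => (S × S) × (ℝ≥0∞ × ℝ≥0∞)) 0 := rfl
  rw [h, ← Measure.map_map (by fun_prop) (by fun_prop), pathLaw, Kernel.trajMeasure,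
    Measure.map_comp _ _ (by fun_prop), Kernel.traj_map_frestrictLe, Kernel.partialTraj_self,
    Measure.id_comp, Measure.map_map (by fun_prop) (by fun_prop)]
  exact Measure.map_id

theorem pathLaw_step (C : M.CouplingModel) (p : S × S) (n : ℕ)
    {E : Set ((i : Finset.Iic n) → (S × S) × (ℝ≥0∞ × ℝ≥0∞))} (hE : MeasurableSet E)
    {B : Set ((S × S) × (ℝ≥0∞ × ℝ≥0∞))} (hB : MeasurableSet B) (c : ℝ≥0∞)
    (h : ∀ x ∈ E, C.stepKernel (x ⟨n, Finset.mem_Iic.2 le_rfl⟩) B = c) :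
    C.pathLaw p {π | Preorder.frestrictLe n π ∈ E ∧ π (n + 1) ∈ B} =
      C.pathLaw p {π | Preorder.frestrictLe n π ∈ E} * c := by
  have key := Kernel.map_frestrictLe_trajMeasure_compProd_eq_map_trajMeasure
    (X := fun _ => (S × S) × (ℝ≥0∞ × ℝ≥0∞)) (μ₀ := C.emitKernel p)
    (κ := fun n => C.stepKernel.comap (fun x => x ⟨n, Finset.mem_Iic.2 le_rfl⟩) (by fun_prop))
    (a := n)
  have key2 := congrArg (fun μ => μ (E ×ˢ B)) key
  rw [Measure.compProd_apply_prod hE hB, Measure.map_apply (by fun_prop) (hE.prod hB)] at key2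
  refine Eq.trans key2.symm ?_
  rw [setLIntegral_congr_fun (g := fun _ => c) hE (fun x hx => by simpa using h x hx),
    setLIntegral_const, Measure.map_apply (by fun_prop) hE, mul_comm]
  rfl

theorem emitKernel_apply_prod (C : M.CouplingModel) (u v : S × S) (R : Set (ℝ≥0∞ × ℝ≥0∞)) :
    C.emitKernel u ({v} ×ˢ R) = Set.indicator {v} 1 u * C.delayLaw u R := by
  rw [emitKernel, Kernel.prod_apply, Measure.prod_prod, Kernel.id_apply,
    Measure.dirac_apply' _ (measurableSet_singleton _)]
  rfl

theorem stepKernel_apply_prod (C : M.CouplingModel) (x : (S × S) × (ℝ≥0∞ × ℝ≥0∞)) (v : S × S)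
    {R : Set (ℝ≥0∞ × ℝ≥0∞)} (hR : MeasurableSet R) :
    C.stepKernel x ({v} ×ˢ R) = C.nextLaw x.1 {v} * C.delayLaw v R := by
  rw [stepKernel, Kernel.comap_apply, Kernel.comp_apply' _ _ _ ((measurableSet_singleton _).prod hR)]
  have : ∀ u, C.emitKernel u ({v} ×ˢ R) = Set.indicator {v} (fun _ => C.delayLaw v R) u := by
    intro u
    rw [emitKernel_apply_prod]
    by_cases huv : u = v <;> simp [huv]
  simp only [this]
  rw [lintegral_indicator_const (measurableSet_singleton _), mul_comm]
  rfl

open Classical in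
/-- Initial condition of the path measure. -/
theorem pathLaw_cylinder_zero (C : M.CouplingModel) (p : S × S) (u : ℕ → S × S)
    (R : ℕ → Set (ℝ≥0∞ × ℝ≥0∞)) :
    C.pathLaw p (cylinderSet u R 0) = if u 0 = p then 1 else 0 := by
  have hE : cylinderSet u R 0 = (fun π : CoupledPath S => π 0) ⁻¹' ({u 0} ×ˢ Set.univ) := by
    ext π; simp [cylinderSet]
  rw [hE, ← Measure.map_apply (by fun_prop) ((measurableSet_singleton _).prod .univ),
    pathLaw_map_zero, emitKernel_apply_prod]
  simp [Set.indicator_apply, eq_comm]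

theorem pathLaw_cylinder_step (C : M.CouplingModel) (p : S × S) (u : ℕ → S × S)
    (R : ℕ → Set (ℝ≥0∞ × ℝ≥0∞)) (hR : ∀ i, MeasurableSet (R i)) (n : ℕ)
    {R' : Set (ℝ≥0∞ × ℝ≥0∞)} (hR' : MeasurableSet R') :
    C.pathLaw p {π | (π ∈ cylinderSet u R n ∧ (π n).2 ∈ R n) ∧ π (n + 1) ∈ {u (n + 1)} ×ˢ R'} =
      C.pathLaw p {π | π ∈ cylinderSet u R n ∧ (π n).2 ∈ R n} *
        (C.nextLaw (u n) {u (n + 1)} * C.delayLaw (u (n + 1)) R') := by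
  let E : Set ((i : Finset.Iic n) → (S × S) × (ℝ≥0∞ × ℝ≥0∞)) :=
    {x | ∀ i, x i ∈ {u i.1} ×ˢ R i.1}
  have hE : MeasurableSet E := by
    have : E = ⋂ i, (fun x : (i : Finset.Iic n) → (S × S) × (ℝ≥0∞ × ℝ≥0∞) => x i) ⁻¹'
        ({u i.1} ×ˢ R i.1) := by
      ext x; simp [E]
    rw [this]
    exact .iInter fun i => (measurable_pi_apply i) ((measurableSet_singleton _).prod (hR _))
  have hiff : ∀ π : CoupledPath S,
      (π ∈ cylinderSet u R n ∧ (π n).2 ∈ R n) ↔ Preorder.frestrictLe n π ∈ E := by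
    intro π
    constructor
    · rintro ⟨⟨h1, h2⟩, h3⟩ ⟨i, hi⟩
      have hi' : i ≤ n := Finset.mem_Iic.1 hi
      refine ⟨h1 i hi', ?_⟩
      rcases hi'.lt_or_eq with h | rfl
      · exact h2 i h
      · exact h3
    · intro h
      exact ⟨⟨fun i hi => (h ⟨i, Finset.mem_Iic.2 hi⟩).1,
        fun i hi => (h ⟨i, Finset.mem_Iic.2 hi.le⟩).2⟩, (h ⟨n, Finset.mem_Iic.2 le_rfl⟩).2⟩
  simp only [hiff]
  refine C.pathLaw_step p n hE ((measurableSet_singleton _).prod hR') _ fun x hx => ?_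
  have hx1 : (x ⟨n, Finset.mem_Iic.2 le_rfl⟩).1 = u n := (hx ⟨n, Finset.mem_Iic.2 le_rfl⟩).1
  rw [stepKernel_apply_prod _ _ _ hR', hx1]

theorem pathLaw_cylinder_next (C : M.CouplingModel) (p : S × S) (u : ℕ → S × S)
    (R : ℕ → Set (ℝ≥0∞ × ℝ≥0∞)) (hR : ∀ i, MeasurableSet (R i)) (n : ℕ) :
    C.pathLaw p (cylinderSet u R (n + 1)) =
      C.pathLaw p {π | π ∈ cylinderSet u R n ∧ (π n).2 ∈ R n} * C.nextLaw (u n) {u (n + 1)} := by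
  have h := C.pathLaw_cylinder_step p u R hR n MeasurableSet.univ
  rw [measure_univ, mul_one] at h
  rw [← h]
  congr 1
  ext π
  rw [mem_cylinderSet_succ]
  simp

theorem pathLaw_cylinder_delay (C : M.CouplingModel) (p : S × S) (u : ℕ → S × S)
    (R : ℕ → Set (ℝ≥0∞ × ℝ≥0∞)) (hR : ∀ i, MeasurableSet (R i)) (n : ℕ) :
    C.pathLaw p {π | π ∈ cylinderSet u R n ∧ (π n).2 ∈ R n} =
      C.pathLaw p (cylinderSet u R n) * C.delayLaw (u n) (R n) := by
  classical
  cases n with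
  | zero =>
    have hE : {π | π ∈ cylinderSet u R 0 ∧ (π 0).2 ∈ R 0} =
        (fun π : CoupledPath S => π 0) ⁻¹' ({u 0} ×ˢ R 0) := by
      ext π; simp [cylinderSet]
    rw [hE, ← Measure.map_apply (by fun_prop) ((measurableSet_singleton _).prod (hR 0)),
      pathLaw_map_zero, emitKernel_apply_prod, pathLaw_cylinder_zero]
    by_cases h : u 0 = p
    · simp [h]
    · simp [h, Ne.symm h]
  | succ n =>
    rw [pathLaw_cylinder_next C p u R hR, mul_assoc, ← pathLaw_cylinder_step C p u R hR n (hR _)]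
    congr 1
    ext π
    simp only [Set.mem_ofPred_eq, mem_cylinderSet_succ, Set.mem_prod, Set.mem_singleton_iff]
    tauto

/-- Inductive equation of the path measure: the probability of the transition out of `u n` is the
product of the probability of the delays and that of the next pair. -/
theorem pathLaw_cylinder_succ (C : M.CouplingModel) (p : S × S) (u : ℕ → S × S)
    (R : ℕ → Set (ℝ≥0∞ × ℝ≥0∞)) (hR : ∀ i, MeasurableSet (R i)) (n : ℕ) :
    C.pathLaw p (cylinderSet u R (n + 1)) =
      C.pathLaw p (cylinderSet u R n) *
        (C.delayLaw (u n) (R n) * C.nextLaw (u n) {u (n + 1)}) := by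
  rw [pathLaw_cylinder_next C p u R hR, pathLaw_cylinder_delay C p u R hR, mul_assoc]

/-- The discrepancy `(Pr_{s,s'} # η)(≢)`, i.e. the probability that the two components of a coupled
timed path started in `p = (s, s')` differ. -/
def discrepancy (C : M.CouplingModel) (p : S × S) : I :=
  ⟨((C.pathLaw p).map decouple).real M.discrepancySet, measureReal_nonneg,
    have := Measure.isProbabilityMeasure_map (μ := C.pathLaw p) measurable_decouple.aemeasurable
    measureReal_le_one⟩

end SMM.CouplingModel

/-- `ϑ(s,s')`: the least discrepancy over all coupling models. -/
def SMM.theta {AP S : Type*} [Fintype S] [MeasurableSpace S] [DiscreteMeasurableSpace S]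
    (M : SMM AP S) (p : S × S) : I :=
  ⨅ C : M.CouplingModel, C.discrepancy p

end

/-!
The least discrepancy is the least fixed point of `F` because first-step analysis turns the
discrepancy of a coupling model into a fixed point of an operator that has the shape of `F`, with
the probability of distinct delays in place of the total variation distance and the expected cost of
the chosen transition coupling in place of the Kantorovich lifting.

For the path measure, let `survival n p` be the probability that no discrepancy occurs at the
positions below `n`. The Markov property (`setLIntegral_agreementUpTo_succ`) identifies it with a
quantity computed by backward recursion, which yields the first-step equations `survival_succ` and
`discrepancyUpTo_succ`; letting `n → ∞` gives `discrepancy_eq`.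

* *Lower bound.* The coupling inequality and the definition of the Kantorovich lifting as an infimum
  show that the discrepancy of every coupling model is a pre-fixed point of `F`, so it lies above the
  least fixed point (`leastFixedPoint_le_discrepancy`).
* *Attainment.* Choose in every non-absorbing pair a maximal coupling of the residence times
  (`exists_maximal_coupling`) and a transition coupling that is optimal for the least fixed point
  (`exists_optimal_coupling`). For this model, induction on `n` keeps the discrepancy below position
  `n` under the least fixed point (`discrepancyUpTo_optimalCouplingModel_le`), hence also its limit.
-/

noncomputable section

/-! ### Total variation and maximal couplings -/

section TotalVariation

variable {X : Type*} [MeasurableSpace X] {μ ν : Measure X}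

theorem abs_sub_le_tvDistance [IsProbabilityMeasure μ] [IsProbabilityMeasure ν]
    {E : Set X} (hE : MeasurableSet E) :
    |μ.real E - ν.real E| ≤ tvDistance μ ν := by
  refine le_ciSup (f := fun E : {E : Set X // MeasurableSet E} => |μ.real E.1 - ν.real E.1|)
    ⟨1, ?_⟩ ⟨E, hE⟩
  rintro _ ⟨E, rfl⟩
  rw [abs_le]
  constructor <;>
    linarith [measureReal_nonneg (μ := μ) (s := E.1), measureReal_nonneg (μ := ν) (s := E.1),
      measureReal_le_one (μ := μ) (s := E.1), measureReal_le_one (μ := ν) (s := E.1)]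

/-- The coupling inequality. -/
theorem tvDistance_le_of_coupling {ω : Measure (X × X)} [IsFiniteMeasure ω]
    (h : MeasureCoupling μ ν ω) : tvDistance μ ν ≤ ω.real {t | t.1 ≠ t.2} := by
  refine Real.iSup_le (fun E => ?_) measureReal_nonneg
  have h1 : μ.real E.1 = ω.real (Prod.fst ⁻¹' E.1) := by
    rw [← h.1, map_measureReal_apply measurable_fst E.2]
  have h2 : ν.real E.1 = ω.real (Prod.snd ⁻¹' E.1) := by
    rw [← h.2, map_measureReal_apply measurable_snd E.2]
  have key : ∀ A B : Set (X × X), A ⊆ B ∪ {t | t.1 ≠ t.2} →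
      ω.real A ≤ ω.real B + ω.real {t | t.1 ≠ t.2} := fun A B hAB =>
    (measureReal_mono hAB).trans (measureReal_union_le _ _)
  have h3 := key (Prod.fst ⁻¹' E.1) (Prod.snd ⁻¹' E.1) fun t ht => by
    by_cases e : t.1 = t.2
    · left; simpa [← e] using ht
    · exact Or.inr e
  have h4 := key (Prod.snd ⁻¹' E.1) (Prod.fst ⁻¹' E.1) fun t ht => by
    by_cases e : t.1 = t.2
    · left; simpa [e] using ht
    · exact Or.inr e
  rw [h1, h2, abs_le]
  constructor <;> linarith

/-- Existence of a maximal coupling: `μ` and `ν` can be coupled so that the components differ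
with probability at most (hence exactly) the total variation distance. On a Hahn set `s`, where
`ν ≤ μ`, and on its complement, where `μ ≤ ν`, the common part is the smaller of the two measures;
it is put on the diagonal, and the remainders are coupled independently. -/
theorem exists_maximal_coupling [MeasurableEq X] (μ ν : Measure X)
    [IsProbabilityMeasure μ] [IsProbabilityMeasure ν] :
    ∃ ω : ProbabilityMeasure (X × X), MeasureCoupling μ ν (ω : Measure (X × X)) ∧
      (ω : Measure (X × X)).real {t | t.1 ≠ t.2} ≤ tvDistance μ ν := by
  obtain ⟨s, hs, hs1, hs2⟩ := hahn_decomposition μ ν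
  have le1 : ν.restrict s ≤ μ.restrict s := Measure.le_iff.2 fun t ht => by
    rw [Measure.restrict_apply ht, Measure.restrict_apply ht]
    exact hs1 _ (ht.inter hs) Set.inter_subset_right
  have le2 : μ.restrict sᶜ ≤ ν.restrict sᶜ := Measure.le_iff.2 fun t ht => by
    rw [Measure.restrict_apply ht, Measure.restrict_apply ht]
    exact hs2 _ (ht.inter hs.compl) Set.inter_subset_right
  set m := ν.restrict s + μ.restrict sᶜ with hm
  set μ' := μ.restrict s - ν.restrict s with hμ'
  set ν' := ν.restrict sᶜ - μ.restrict sᶜ with hν'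
  have eμ : m + μ' = μ := by
    rw [hm, hμ', add_right_comm, add_comm (ν.restrict s), Measure.sub_add_cancel_of_le le1,
      Measure.restrict_add_restrict_compl hs]
  have eν : m + ν' = ν := by
    rw [hm, hν', add_assoc, add_comm (μ.restrict sᶜ), Measure.sub_add_cancel_of_le le2,
      Measure.restrict_add_restrict_compl hs]
  have mass : μ' Set.univ = ν' Set.univ := by
    have h1 : m Set.univ + μ' Set.univ = 1 := by
      rw [← Measure.add_apply, eμ, measure_univ]
    have h2 : m Set.univ + ν' Set.univ = 1 := by
      rw [← Measure.add_apply, eν, measure_univ]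
    exact (ENNReal.add_right_inj (measure_ne_top m _)).1 (h1.trans h2.symm)
  have massreal : μ'.real Set.univ ≤ tvDistance μ ν := by
    have h : (m + μ').real s = μ.real s := by rw [eμ]
    have hms : m.real s = ν.real s := by
      simp [measureReal_def, hm, Measure.restrict_apply hs]
    have hμs : μ'.real s = μ'.real Set.univ := by
      rw [measureReal_def, measureReal_def]
      congr 1
      have h0 : μ' sᶜ = 0 := by
        refine nonpos_iff_eq_zero.1 ((Measure.sub_le _).trans ?_)
        simp [Measure.restrict_apply hs.compl]
      rw [← measure_add_measure_compl hs (μ := μ'), h0, add_zero]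
    rw [measureReal_add_apply, hms, hμs] at h
    have := (le_abs_self _).trans (abs_sub_le_tvDistance (μ := μ) (ν := ν) hs)
    linarith
  -- If `μ'` has mass `0` then `(μ' univ)⁻¹ = ∞`, but the product it multiplies is `0`.
  set ω : Measure (X × X) := m.map (fun x => (x, x)) + (μ' Set.univ)⁻¹ • μ'.prod ν' with hω
  have scale : ∀ κ : Measure X, κ Set.univ = μ' Set.univ →
      ((μ' Set.univ)⁻¹ * μ' Set.univ) • κ = κ := by
    intro κ hκ
    by_cases h0 : μ' Set.univ = 0
    · rw [h0, Measure.measure_univ_eq_zero] at hκ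
      simp [hκ]
    · rw [ENNReal.inv_mul_cancel h0 (measure_ne_top _ _), one_smul]
  have hdiag : Measurable fun x : X => (x, x) := by fun_prop
  have hfst : ω.map Prod.fst = μ := by
    rw [hω, Measure.map_add _ _ measurable_fst, Measure.map_map measurable_fst hdiag,
      Measure.map_smul, Measure.map_fst_prod, smul_smul, ← mass, scale μ' rfl]
    exact (congrArg (· + μ') Measure.map_id).trans eμ
  have hsnd : ω.map Prod.snd = ν := by
    rw [hω, Measure.map_add _ _ measurable_snd, Measure.map_map measurable_snd hdiag,
      Measure.map_smul, Measure.map_snd_prod, smul_smul, scale ν' mass.symm]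
    exact (congrArg (· + ν') Measure.map_id).trans eν
  have hprob : IsProbabilityMeasure ω := by
    constructor
    rw [← Set.preimage_univ (f := Prod.fst), ← Measure.map_apply measurable_fst .univ, hfst,
      measure_univ]
  refine ⟨⟨ω, hprob⟩, ⟨hfst, hsnd⟩, le_trans ?_ massreal⟩
  refine ENNReal.toReal_mono (measure_ne_top _ _) ?_
  have hD : MeasurableSet {t : X × X | t.1 ≠ t.2} :=
    (measurableSet_eq_fun measurable_fst measurable_snd).compl
  change ω _ ≤ _
  rw [hω, Measure.add_apply, Measure.map_apply hdiag hD, Measure.smul_apply]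
  have h0 : (fun x : X => (x, x)) ⁻¹' {t : X × X | t.1 ≠ t.2} = ∅ := by ext; simp
  rw [h0, measure_empty, zero_add, smul_eq_mul]
  calc (μ' Set.univ)⁻¹ * μ'.prod ν' {t | t.1 ≠ t.2}
      ≤ (μ' Set.univ)⁻¹ * (μ' Set.univ * ν' Set.univ) := by
        gcongr
        exact (measure_mono (Set.subset_univ _)).trans_eq (by
          rw [← Set.univ_prod_univ, Measure.prod_prod])
    _ ≤ 1 * ν' Set.univ := by
        rw [← mul_assoc]
        gcongr
        exact ENNReal.inv_mul_le_one _
    _ = μ' Set.univ := by rw [one_mul, mass]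

end TotalVariation

/-! ### Optimal couplings of distributions on a finite set -/

section OptimalCoupling

variable {S : Type*} [Fintype S]

theorem discreteCoupling_iff {μ ν : PMF S} {ω : PMF (S × S)} :
    DiscreteCoupling μ ν ω ↔ (∀ x, ∑ y, ω (x, y) = μ x) ∧ ∀ y, ∑ x, ω (x, y) = ν y := by
  classical
  have h1 : ∀ x, ω.map Prod.fst x = ∑ y, ω (x, y) := fun x => by
    rw [PMF.map_apply, tsum_fintype, Fintype.sum_prod_type, Finset.sum_comm]
    simp
  have h2 : ∀ y, ω.map Prod.snd y = ∑ x, ω (x, y) := fun y => by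
    rw [PMF.map_apply, tsum_fintype, Fintype.sum_prod_type_right, Finset.sum_comm]
    simp
  simp only [DiscreteCoupling, PMF.ext_iff, h1, h2]

/-- The infimum defining the Kantorovich lifting is attained: the couplings form a closed subset of
the compact space `S × S → [0,∞]`, on which the cost is continuous. -/
theorem exists_optimal_coupling (d : S × S → I) (μ ν : PMF S) :
    ∃ ω : PMF (S × S), DiscreteCoupling μ ν ω ∧
      ∑ p, (ω p).toReal * (d p : ℝ) = kantorovich d μ ν := by
  set K : Set (S × S → ℝ≥0∞) :=
    {w | (∀ x, ∑ y, w (x, y) = μ x) ∧ ∀ y, ∑ x, w (x, y) = ν y} with hK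
  have hclosed : IsClosed K := by
    simp only [hK, Set.ofPred_and, Set.ofPred_forall]
    refine .inter (isClosed_iInter fun x => ?_) (isClosed_iInter fun y => ?_) <;>
      exact isClosed_eq (by fun_prop) (by fun_prop)
  have hcont : Continuous fun w : S × S → ℝ≥0∞ => ∑ p, w p * ENNReal.ofReal (d p) :=
    continuous_finsetSum _ fun p _ =>
      (ENNReal.continuous_mul_const ENNReal.ofReal_ne_top).comp (continuous_apply p)
  obtain ⟨⟨ω₀, hω₀⟩⟩ := nonempty_discreteCoupling μ ν
  obtain ⟨w, hwK, hmin⟩ := hclosed.isCompact.exists_isMinOn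
    ⟨fun p => ω₀ p, discreteCoupling_iff.1 hω₀⟩ hcont.continuousOn
  let ω : PMF (S × S) := PMF.ofFintype w (by
    rw [Fintype.sum_prod_type, Finset.sum_congr rfl fun x _ => hwK.1 x,
      ← tsum_fintype (L := .unconditional _), μ.tsum_coe])
  have hω : DiscreteCoupling μ ν ω := discreteCoupling_iff.2 hwK
  have toReal_cost : ∀ κ : PMF (S × S), (∑ p, κ p * ENNReal.ofReal (d p)).toReal =
      ∑ p, (κ p).toReal * (d p : ℝ) := fun κ => by
    rw [ENNReal.toReal_sum fun p _ => ENNReal.mul_ne_top (κ.apply_ne_top p) ENNReal.ofReal_ne_top]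
    exact Finset.sum_congr rfl fun p _ => by
      rw [ENNReal.toReal_mul, ENNReal.toReal_ofReal (d p).2.1]
  refine ⟨ω, hω, le_antisymm ?_ (ciInf_le (kantorovich_bddBelow d μ ν) ⟨ω, hω⟩)⟩
  have : Nonempty {ω : PMF (S × S) // DiscreteCoupling μ ν ω} := ⟨⟨ω, hω⟩⟩
  refine le_ciInf fun κ => ?_
  rw [← toReal_cost, ← toReal_cost]
  refine ENNReal.toReal_mono (ENNReal.sum_ne_top.2 fun p _ =>
    ENNReal.mul_ne_top (κ.1.apply_ne_top p) ENNReal.ofReal_ne_top) ?_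
  exact hmin (discreteCoupling_iff.1 κ.2)

end OptimalCoupling

/-! ### Survival probabilities of coupled timed paths -/

namespace SMM

variable {AP S : Type*}

/-- The pairs of states and delays that witness no discrepancy: equivalent states, equal delays. -/
def agreement (M : SMM AP S) : Set ((S × S) × (ℝ≥0∞ × ℝ≥0∞)) :=
  {x | M.Similar x.1.1 x.1.2 ∧ x.2.1 = x.2.2}

/-- The coupled paths without discrepancy at the positions below `n`. -/
def agreementUpTo (M : SMM AP S) (n : ℕ) : Set (CoupledPath S) := {π | ∀ k < n, π k ∈ M.agreement}

namespace CouplingModel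

variable [Fintype S] [MeasurableSpace S] [DiscreteMeasurableSpace S] {M : SMM AP S}

theorem measurableSet_agreement : MeasurableSet M.agreement := by
  refine MeasurableSet.inter (s₁ := Prod.fst ⁻¹' {p : S × S | M.Similar p.1 p.2})
    (measurable_fst .of_discrete) ?_
  exact measurableSet_eq_fun (by fun_prop) (by fun_prop)

theorem measurableSet_agreementUpTo (n : ℕ) : MeasurableSet (M.agreementUpTo n) := by
  simp only [agreementUpTo, Set.ofPred_forall]
  exact .iInter fun k => .iInter fun _ => measurable_pi_apply k measurableSet_agreement

/-- `C.survival n p` is the probability that a coupled path from `p` shows no discrepancy at the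
positions below `n`. -/
def survival (C : M.CouplingModel) (n : ℕ) (p : S × S) : ℝ≥0∞ := C.pathLaw p (M.agreementUpTo n)

/-- Given that position `0` of a coupled path is `x`, the probability of no discrepancy at the
positions below `n`, computed by backward recursion along the step kernel. -/
def survivalFrom (C : M.CouplingModel) : ℕ → (S × S) × (ℝ≥0∞ × ℝ≥0∞) → ℝ≥0∞
  | 0 => 1
  | n + 1 => M.agreement.indicator fun x => ∫⁻ y, survivalFrom C n y ∂C.stepKernel x

theorem measurable_survivalFrom (C : M.CouplingModel) (n : ℕ) : Measurable (C.survivalFrom n) := by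
  induction n with
  | zero => exact measurable_const
  | succ n ih => exact (ih.lintegral_kernel).indicator measurableSet_agreement

/-- The Markov property at time `n`, on the event of no discrepancy up to time `n`. -/
theorem setLIntegral_agreementUpTo_succ (C : M.CouplingModel) (p : S × S) (n : ℕ)
    {h : (S × S) × (ℝ≥0∞ × ℝ≥0∞) → ℝ≥0∞} (hh : Measurable h) :
    ∫⁻ π in M.agreementUpTo (n + 1), h (π (n + 1)) ∂C.pathLaw p =
      ∫⁻ π in M.agreementUpTo n,
        M.agreement.indicator (fun x => ∫⁻ y, h y ∂C.stepKernel x) (π n) ∂C.pathLaw p := by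
  have key := Kernel.map_frestrictLe_trajMeasure_compProd_eq_map_trajMeasure
    (X := fun _ => (S × S) × (ℝ≥0∞ × ℝ≥0∞)) (μ₀ := C.emitKernel p)
    (κ := fun n => C.stepKernel.comap (fun x => x ⟨n, Finset.mem_Iic.2 le_rfl⟩) (by fun_prop))
    (a := n)
  change (C.pathLaw p).map _ ⊗ₘ _ = (C.pathLaw p).map _ at key
  let E : Set ((i : Finset.Iic n) → (S × S) × (ℝ≥0∞ × ℝ≥0∞)) := {x | ∀ i, x i ∈ M.agreement}
  have hE : MeasurableSet E := by
    simp only [E, Set.ofPred_forall]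
    exact .iInter fun i => measurable_pi_apply i measurableSet_agreement
  have hEU : Preorder.frestrictLe (π := fun _ : ℕ => (S × S) × (ℝ≥0∞ × ℝ≥0∞)) n ⁻¹' E =
      M.agreementUpTo (n + 1) := by
    ext π
    simp [E, agreementUpTo]
  have hG : Measurable fun z : ((i : Finset.Iic n) → (S × S) × (ℝ≥0∞ × ℝ≥0∞)) ×
      ((S × S) × (ℝ≥0∞ × ℝ≥0∞)) => E.indicator (fun _ => h z.2) z.1 := by
    have : (fun z : ((i : Finset.Iic n) → (S × S) × (ℝ≥0∞ × ℝ≥0∞)) ×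
      ((S × S) × (ℝ≥0∞ × ℝ≥0∞)) => E.indicator (fun _ => h z.2) z.1) =
      (Prod.fst ⁻¹' E).indicator fun z => h z.2 := rfl
    rw [this]
    exact (hh.comp measurable_snd).indicator (measurable_fst hE)
  have key2 := congrArg (fun μ => ∫⁻ z, E.indicator (fun _ => h z.2) z.1 ∂μ) key
  rw [Measure.lintegral_compProd hG, lintegral_map hG.lintegral_kernel_prod_right' (by fun_prop),
    lintegral_map hG (by fun_prop)] at key2
  rw [← lintegral_indicator (measurableSet_agreementUpTo _),
    ← lintegral_indicator (measurableSet_agreementUpTo _)]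
  refine Eq.trans ?_ (key2.symm.trans ?_)
  · refine lintegral_congr fun π => ?_
    rw [← hEU]
    rfl
  · refine lintegral_congr fun π => ?_
    by_cases hπ : π ∈ M.agreementUpTo (n + 1)
    · have h1 : Preorder.frestrictLe n π ∈ E := by rw [← hEU] at hπ; exact hπ
      have h2 : π ∈ M.agreementUpTo n := fun k hk => hπ k (hk.trans n.lt_succ_self)
      rw [Set.indicator_of_mem h2, Set.indicator_of_mem (hπ n n.lt_succ_self)]
      exact lintegral_congr fun _ => Set.indicator_of_mem h1 _
    · have h1 : Preorder.frestrictLe n π ∉ E := by rw [← hEU] at hπ; exact hπ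
      refine (lintegral_congr fun _ => Set.indicator_of_notMem h1 _).trans ?_
      rw [lintegral_zero]
      by_cases h2 : π ∈ M.agreementUpTo n
      · have h3 : π n ∉ M.agreement := fun h3 => hπ fun k hk =>
          (Nat.lt_succ_iff_lt_or_eq.1 hk).elim (h2 k) fun e => e ▸ h3
        rw [Set.indicator_of_mem h2, Set.indicator_of_notMem h3]
      · rw [Set.indicator_of_notMem h2]

/-- The forward description of survival by the path measure agrees with the backward recursion:
the Markov property moves one step at a time from the path measure into `survivalFrom`. -/
theorem survival_eq_lintegral (C : M.CouplingModel) (n : ℕ) (p : S × S) :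
    C.survival n p = ∫⁻ x, C.survivalFrom n x ∂C.emitKernel p := by
  have h : ∀ m n, ∫⁻ π in M.agreementUpTo m, C.survivalFrom n (π m) ∂C.pathLaw p =
      C.survival (m + n) p := by
    intro m n
    induction n generalizing m with
    | zero => simp [survivalFrom, survival]
    | succ n ih =>
      rw [survivalFrom, ← setLIntegral_agreementUpTo_succ C p m (C.measurable_survivalFrom n), ih]
      congr 1
      omega
  have h0 : M.agreementUpTo 0 = Set.univ := by ext; simp [agreementUpTo]
  rw [← C.pathLaw_map_zero, lintegral_map (C.measurable_survivalFrom n) (by fun_prop)]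
  simpa [h0] using (h 0 n).symm

@[simp] theorem survival_zero (C : M.CouplingModel) (p : S × S) : C.survival 0 p = 1 := by
  simp [survival, agreementUpTo]

/-- First-step analysis. -/
theorem survival_succ (C : M.CouplingModel) (n : ℕ) {p : S × S} (hp : M.Similar p.1 p.2) :
    C.survival (n + 1) p =
      C.delayLaw p {t | t.1 = t.2} * ∑ q, C.nextLaw p {q} * C.survival n q := by
  have hstep : ∀ t, ∫⁻ y, C.survivalFrom n y ∂C.stepKernel (p, t) =
      ∑ q, C.nextLaw p {q} * C.survival n q := by
    intro t
    rw [stepKernel, Kernel.comap_apply,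
      Kernel.lintegral_comp _ _ _ (C.measurable_survivalFrom n), lintegral_fintype]
    refine Finset.sum_congr rfl fun q _ => ?_
    rw [survival_eq_lintegral, mul_comm]
    rfl
  rw [survival_eq_lintegral, emitKernel,
    Kernel.lintegral_id_prod (C.measurable_survivalFrom (n + 1))]
  have hD : MeasurableSet {t : ℝ≥0∞ × ℝ≥0∞ | t.1 = t.2} :=
    measurableSet_eq_fun measurable_fst measurable_snd
  have : ∀ t, C.survivalFrom (n + 1) (p, t) =
      Set.indicator {t : ℝ≥0∞ × ℝ≥0∞ | t.1 = t.2}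
        (fun _ => ∑ q, C.nextLaw p {q} * C.survival n q) t := by
    intro t
    by_cases ht : t.1 = t.2
    · rw [survivalFrom, Set.indicator_of_mem (show (p, t) ∈ M.agreement from ⟨hp, ht⟩), hstep,
        Set.indicator_of_mem (show t ∈ {t : ℝ≥0∞ × ℝ≥0∞ | t.1 = t.2} from ht)]
    · rw [survivalFrom, Set.indicator_of_notMem fun h => ht h.2,
        Set.indicator_of_notMem (show t ∉ {t : ℝ≥0∞ × ℝ≥0∞ | t.1 = t.2} from ht)]
  simp only [this]
  rw [lintegral_indicator_const hD, mul_comm]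
  rfl

theorem survival_succ_of_not_similar (C : M.CouplingModel) (n : ℕ) {p : S × S}
    (hp : ¬ M.Similar p.1 p.2) : C.survival (n + 1) p = 0 := by
  rw [survival_eq_lintegral, emitKernel,
    Kernel.lintegral_id_prod (C.measurable_survivalFrom (n + 1))]
  have : ∀ t, C.survivalFrom (n + 1) (p, t) = 0 := fun t =>
    Set.indicator_of_notMem (fun h => hp h.1) _
  simp [this]

end CouplingModel
end SMM

/-! ### The discrepancy as a fixed point -/

namespace SMM.CouplingModel

variable {AP S : Type*} [Fintype S] [MeasurableSpace S] [DiscreteMeasurableSpace S] {M : SMM AP S}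

theorem survival_ne_top (C : M.CouplingModel) (n : ℕ) (p : S × S) : C.survival n p ≠ ∞ :=
  measure_ne_top _ _

/-- The probability of a discrepancy at some position below `n`. -/
def discrepancyUpTo (C : M.CouplingModel) (n : ℕ) (p : S × S) : ℝ := 1 - (C.survival n p).toReal

theorem tendsto_discrepancyUpTo (C : M.CouplingModel) (p : S × S) :
    Filter.Tendsto (fun n => C.discrepancyUpTo n p) Filter.atTop (nhds (C.discrepancy p : ℝ)) := by
  have hm := measurableSet_agreementUpTo (M := M)
  have hcompl : decouple ⁻¹' M.discrepancySet = (⋂ n, M.agreementUpTo n)ᶜ := by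
    ext π
    simp only [Set.mem_preimage, discrepancySet, Set.mem_ofPred_eq, Set.mem_compl_iff,
      Set.mem_iInter, agreementUpTo, not_forall]
    constructor
    · rintro ⟨k, hk⟩
      exact ⟨k + 1, k, k.lt_succ_self, fun h => hk.elim (· h.1) (· h.2)⟩
    · rintro ⟨_, k, _, hk⟩
      exact ⟨k, by rw [← not_and_or]; exact hk⟩
  have hmeas : MeasurableSet M.discrepancySet := by
    simp only [discrepancySet, Set.ofPred_exists]
    refine .iUnion fun k => ?_
    refine MeasurableSet.union (s₁ := (fun π : TimedPath S × TimedPath S =>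
      ((π.1 k).1, (π.2 k).1)) ⁻¹' {p : S × S | ¬ M.Similar p.1 p.2})
      ((by fun_prop : Measurable _) .of_discrete) ?_
    exact (measurableSet_eq_fun (by fun_prop) (by fun_prop)).compl
  have hd : (C.discrepancy p : ℝ) = 1 - (C.pathLaw p (⋂ n, M.agreementUpTo n)).toReal := by
    change ((C.pathLaw p).map decouple).real M.discrepancySet = _
    rw [map_measureReal_apply measurable_decouple hmeas, hcompl,
      probReal_compl_eq_one_sub (.iInter hm)]
    rfl
  rw [hd]
  refine tendsto_const_nhds.sub ((ENNReal.tendsto_toReal (measure_ne_top _ _)).comp ?_)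
  exact tendsto_measure_iInter_atTop (fun n => (hm n).nullMeasurableSet)
    (fun _ _ hmn _ hπ k hk => hπ k (hk.trans_le hmn)) ⟨0, measure_ne_top _ _⟩

theorem discrepancyUpTo_succ_of_not_similar (C : M.CouplingModel) (n : ℕ) {p : S × S}
    (hp : ¬ M.Similar p.1 p.2) : C.discrepancyUpTo (n + 1) p = 1 := by
  simp [discrepancyUpTo, C.survival_succ_of_not_similar n hp]

theorem discrepancyUpTo_of_absorbing (C : M.CouplingModel) (n : ℕ) {p : S × S}
    (hp : M.Similar p.1 p.2) (hA : p.1 ∈ M.A) : C.discrepancyUpTo n p = 0 := by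
  classical
  have hn : p ∉ (M.coupledAᶜ : Set (S × S)) := fun h => h (Or.inl hA)
  suffices C.survival n p = 1 by simp [discrepancyUpTo, this]
  induction n with
  | zero => simp
  | succ n ih =>
    rw [C.survival_succ n hp, delayLaw, dif_neg hn, nextLaw, dif_neg hn, Finset.sum_eq_single p]
    · simp [ih]
    · intro q _ hq
      simp [Ne.symm hq]
    · simp

/-- First-step analysis: a discrepancy arises in the first delays, or else after the first
transition, which is independent of the delays. -/
theorem discrepancyUpTo_succ (C : M.CouplingModel) (n : ℕ) {p : S × S}
    (hp : M.Similar p.1 p.2) (hA : p ∈ (M.coupledAᶜ : Set (S × S))) :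
    C.discrepancyUpTo (n + 1) p =
      (C.ρ' ⟨p, hA⟩ : Measure (ℝ≥0 × ℝ≥0)).real {t | t.1 ≠ t.2} +
        (1 - (C.ρ' ⟨p, hA⟩ : Measure (ℝ≥0 × ℝ≥0)).real {t | t.1 ≠ t.2}) *
          ∑ q, (C.τ' ⟨p, hA⟩ q).toReal * C.discrepancyUpTo n q := by
  have hdelay : (C.delayLaw p {t | t.1 = t.2}).toReal =
      1 - (C.ρ' ⟨p, hA⟩ : Measure (ℝ≥0 × ℝ≥0)).real {t | t.1 ≠ t.2} := by
    have hD : MeasurableSet {t : ℝ≥0 × ℝ≥0 | t.1 ≠ t.2} :=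
      (measurableSet_eq_fun measurable_fst measurable_snd).compl
    rw [delayLaw, dif_pos hA, Measure.map_apply (by fun_prop)
      (measurableSet_eq_fun measurable_fst measurable_snd), ← probReal_compl_eq_one_sub hD,
      measureReal_def]
    congr 2
    ext t
    simp
  have hnext : ∀ q, C.nextLaw p {q} = C.τ' ⟨p, hA⟩ q := fun q => by
    rw [nextLaw, dif_pos hA, PMF.toMeasure_apply_singleton _ _ (measurableSet_singleton _)]
  have hsum : ∑ q, (C.τ' ⟨p, hA⟩ q).toReal = 1 := by
    rw [← ENNReal.toReal_sum fun q _ => PMF.apply_ne_top _ q,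
      ← tsum_fintype (L := .unconditional _), PMF.tsum_coe, ENNReal.toReal_one]
  simp only [discrepancyUpTo, mul_sub, mul_one, Finset.sum_sub_distrib, hsum]
  rw [C.survival_succ n hp, ENNReal.toReal_mul, hdelay, ENNReal.toReal_sum fun q _ =>
    ENNReal.mul_ne_top (measure_ne_top _ _) (C.survival_ne_top n q)]
  simp only [ENNReal.toReal_mul, hnext]
  ring

theorem discrepancy_of_not_similar (C : M.CouplingModel) {p : S × S}
    (hp : ¬ M.Similar p.1 p.2) : (C.discrepancy p : ℝ) = 1 :=
  tendsto_nhds_unique ((Filter.tendsto_add_atTop_iff_nat 1).2 (C.tendsto_discrepancyUpTo p))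
    (by simpa only [C.discrepancyUpTo_succ_of_not_similar _ hp] using tendsto_const_nhds)

theorem discrepancy_eq (C : M.CouplingModel) {p : S × S}
    (hp : M.Similar p.1 p.2) (hA : p ∈ (M.coupledAᶜ : Set (S × S))) :
    (C.discrepancy p : ℝ) =
      (C.ρ' ⟨p, hA⟩ : Measure (ℝ≥0 × ℝ≥0)).real {t | t.1 ≠ t.2} +
        (1 - (C.ρ' ⟨p, hA⟩ : Measure (ℝ≥0 × ℝ≥0)).real {t | t.1 ≠ t.2}) *
          ∑ q, (C.τ' ⟨p, hA⟩ q).toReal * (C.discrepancy q : ℝ) := by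
  refine tendsto_nhds_unique
    ((Filter.tendsto_add_atTop_iff_nat 1).2 (C.tendsto_discrepancyUpTo p)) ?_
  simp only [C.discrepancyUpTo_succ _ hp hA]
  exact (tendsto_const_nhds.mul (tendsto_finsetSum _ fun q _ =>
    tendsto_const_nhds.mul (C.tendsto_discrepancyUpTo q))).const_add _

/-- The discrepancy of every coupling model is a pre-fixed point of `F`, because its couplings cost
at least the total variation distance and the Kantorovich distance, respectively. -/
theorem leastFixedPoint_le_discrepancy (C : M.CouplingModel) :
    M.leastFixedPoint ≤ C.discrepancy := by
  refine OrderHom.lfp_le _ fun p => ?_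
  change M.operatorFun C.discrepancy p ≤ C.discrepancy p
  unfold operatorFun
  split_ifs with hE hA
  · exact (C.discrepancy p).2.1
  · have hp : p ∈ (M.coupledAᶜ : Set (S × S)) := fun h => h.elim hA fun h' => hA (hE.2.2 h')
    have h1 := tvDistance_le_of_coupling (C.coupling_ρ' ⟨p, hp⟩)
    have h2 : kantorovich C.discrepancy _ _ ≤ _ :=
      ciInf_le (kantorovich_bddBelow C.discrepancy _ _) ⟨_, C.coupling_τ' ⟨p, hp⟩⟩
    have h3 := kantorovich_mem C.discrepancy (M.τ ⟨p.1, fst_mem ⟨p, hp⟩⟩)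
      (M.τ ⟨p.2, snd_mem ⟨p, hp⟩⟩)
    have h4 : (C.ρ' ⟨p, hp⟩ : Measure (ℝ≥0 × ℝ≥0)).real {t | t.1 ≠ t.2} ≤ 1 := measureReal_le_one
    rw [C.discrepancy_eq hE hp]
    dsimp only at h2 ⊢
    nlinarith [mul_le_mul_of_nonneg_left h2 (sub_nonneg.2 h4),
      mul_le_mul_of_nonneg_right h1 (sub_nonneg.2 h3.2)]
  · exact (C.discrepancy_of_not_similar hE).ge

end SMM.CouplingModel

/-! ### An optimal coupling model -/

namespace SMM

variable {AP S : Type*} [Fintype S]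

/-- In every non-absorbing pair, choose a maximal coupling of the residence times and a coupling of
the transitions that is optimal for the least fixed point of `F`. -/
def optimalCouplingModel (M : SMM AP S) : M.CouplingModel where
  τ' p := (exists_optimal_coupling M.leastFixedPoint
    (M.τ ⟨p.1.1, fst_mem p⟩) (M.τ ⟨p.1.2, snd_mem p⟩)).choose
  ρ' p := (exists_maximal_coupling (M.ρ ⟨p.1.1, fst_mem p⟩ : Measure ℝ≥0)
    (M.ρ ⟨p.1.2, snd_mem p⟩ : Measure ℝ≥0)).choose
  coupling_τ' _ := (exists_optimal_coupling M.leastFixedPoint _ _).choose_spec.1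
  coupling_ρ' _ := (exists_maximal_coupling _ _).choose_spec.1

variable [MeasurableSpace S] [DiscreteMeasurableSpace S]

/-- The discrepancies up to `n` of the optimal coupling model stay below the least fixed point, by
induction on `n`: they start at `0`, and passing from `n` to `n + 1` amounts to applying `F` with
the couplings that realise its value at the least fixed point. -/
theorem discrepancyUpTo_optimalCouplingModel_le (M : SMM AP S) (n : ℕ) (p : S × S) :
    M.optimalCouplingModel.discrepancyUpTo n p ≤ M.leastFixedPoint p := by
  induction n generalizing p with
  | zero => simpa [CouplingModel.discrepancyUpTo] using (M.leastFixedPoint p).2.1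
  | succ n ih =>
    have hfix : (M.leastFixedPoint p : ℝ) = M.operatorFun M.leastFixedPoint p :=
      congrArg (fun d : S × S → I => (d p : ℝ)) M.fixedPointOperator.map_lfp.symm
    by_cases hE : M.Similar p.1 p.2
    · by_cases hA : p.1 ∈ M.A
      · rw [CouplingModel.discrepancyUpTo_of_absorbing _ _ hE hA]
        exact (M.leastFixedPoint p).2.1
      · have hp : p ∈ (M.coupledAᶜ : Set (S × S)) := fun h => h.elim hA fun h' => hA (hE.2.2 h')
        rw [CouplingModel.discrepancyUpTo_succ _ n hE hp, hfix, operatorFun, dif_pos hE,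
          dif_neg hA]
        have h1 := (exists_maximal_coupling (M.ρ ⟨p.1, fst_mem ⟨p, hp⟩⟩ : Measure ℝ≥0)
          (M.ρ ⟨p.2, snd_mem ⟨p, hp⟩⟩ : Measure ℝ≥0)).choose_spec.2
        have h2 := (exists_optimal_coupling M.leastFixedPoint (M.τ ⟨p.1, fst_mem ⟨p, hp⟩⟩)
          (M.τ ⟨p.2, snd_mem ⟨p, hp⟩⟩)).choose_spec.2
        have h3 := kantorovich_mem M.leastFixedPoint (M.τ ⟨p.1, fst_mem ⟨p, hp⟩⟩)
          (M.τ ⟨p.2, snd_mem ⟨p, hp⟩⟩)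
        change (M.optimalCouplingModel.ρ' ⟨p, hp⟩ : Measure (ℝ≥0 × ℝ≥0)).real _ ≤ _ at h1
        change ∑ q, (M.optimalCouplingModel.τ' ⟨p, hp⟩ q).toReal * _ = _ at h2
        have h4 : (M.optimalCouplingModel.ρ' ⟨p, hp⟩ : Measure (ℝ≥0 × ℝ≥0)).real
          {t | t.1 ≠ t.2} ≤ 1 := measureReal_le_one
        have h5 : ∑ q, (M.optimalCouplingModel.τ' ⟨p, hp⟩ q).toReal *
            M.optimalCouplingModel.discrepancyUpTo n q ≤ _ :=
          (Finset.sum_le_sum fun q _ =>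
            mul_le_mul_of_nonneg_left (ih q) ENNReal.toReal_nonneg).trans_eq h2
        dsimp only
        nlinarith [mul_le_mul_of_nonneg_left h5 (sub_nonneg.2 h4),
          mul_le_mul_of_nonneg_right h1 (sub_nonneg.2 h3.2)]
    · rw [hfix, operatorFun, dif_neg hE, CouplingModel.discrepancyUpTo_succ_of_not_similar _ _ hE]

theorem discrepancy_optimalCouplingModel (M : SMM AP S) :
    M.optimalCouplingModel.discrepancy = M.leastFixedPoint :=
  le_antisymm
    (fun p => le_of_tendsto' (M.optimalCouplingModel.tendsto_discrepancyUpTo p) fun n =>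
      M.discrepancyUpTo_optimalCouplingModel_le n p)
    M.optimalCouplingModel.leastFixedPoint_le_discrepancy

theorem isLeast_discrepancy (M : SMM AP S) (p : S × S) :
    IsLeast (Set.range fun C : M.CouplingModel => C.discrepancy p) (M.leastFixedPoint p) :=
  ⟨⟨M.optimalCouplingModel, congrFun M.discrepancy_optimalCouplingModel p⟩, by
    rintro _ ⟨C, rfl⟩
    exact C.leastFixedPoint_le_discrepancy p⟩

end SMM

end

theorem mainTheorem9 {AP S : Type*} [Countable AP] [Fintype S] [Nonempty S]
    [MeasurableSpace S] [DiscreteMeasurableSpace S] (M : SMM AP S) :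
    (∀ p : S × S,
      IsLeast (Set.range fun C : M.CouplingModel => C.discrepancy p) (M.theta p)) ∧
    M.theta = M.leastFixedPoint := by
  have h : M.theta = M.leastFixedPoint := funext fun p => (M.isLeast_discrepancy p).isGLB.sInf_eq
  exact ⟨fun p => h ▸ M.isLeast_discrepancy p, h⟩
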